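/- Let $T,n\ge 1$, and let $G$ be the star graph on the vertex set $[T]=\{1,\dots,T\}$ with any vertex as center and edge set $\mathcal E$. Let $D\in\{0,-1,1\}^{|\mathcal E|\times T}$ be the incidence matrix of $G$ for some orientation of its edges, and $M=D\otimes I_n$. For $t\in[T]$ let $C_t\in\mathbb R^{m_t\times n}$; put $C=\mathrm{diag}(C_1,\dots,C_T)\in\mathbb R^{(\sum_t m_t)\times Tn}$ (block diagonal), $O_T=[C_1^\top\ \cdots\ C_T^\top]^\top\in\mathbb R^{(\sum_t m_t)\times n}$, and let $\|C\|_2$ be the spectral norm. Let $x=(x_1,\dots,x_T)\in\mathbb R^{nT}$ and let $S_T>0$ satisfy $\|Mx\|_2^2=\sum_{\{t,t'\}\in\mathcal E}\|x_t-x_{t'}\|_2^2\le S_T$. Let $\underline\lambda,\overline\lambda>0$ satisfy $\underline\lambda\le\lambda_{\min}(O_T^\top O_T)$ and $\lambda_{\max}(O_T^\top O_T)\le\overline\lambda$. Suppose $y=Cx+\eta$, where the random vector $\eta\in\mathbb R^{\sum_t m_t}$ is $\sigma$-subgaussian ($\sigma\ge0$), i.e. $\mathbb E\,e^{s\,u^\top\eta}\le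 e^{s^2\sigma^2/2}$ for all $s\in\mathbb R$ and all unit vectors $u$. For $\mu>0$ let $\hat x$ be a penalized least squares estimate, $$\hat x\in\operatorname*{argmin}_{z\in\mathbb R^{nT}}\Big\{\tfrac12\|y-Cz\|_2^2+\tfrac{\mu}{2}\|Mz\|_2^2\Big\}.$$ Then there exist universal constants $c_1,c_2>0$ (independent of all the quantities above) such that for the choice $$\mu=\mu^*=\max\Big\{(2n\sigma^2\|C\|_2^2)^{1/3}\,\frac{\underline\lambda^{1/3}}{S_T^{1/3}}-\frac{\underline\lambda}{T},\ \ c_1\Big(\frac{\underline\lambda}{T}+\|C\|_2^2\,\frac{\overline\lambda}{\underline\lambda}\Big)\Big\}$$ we have, for every $\delta\in(0,e^{-1})$, with probability at least $1-\delta$, $$\|\hat x-x\|_2^2\le c_2\Big(S_T+\|C\|_2^2\,\frac{\overline\lambda}{\underline\lambda^2}\,T\,S_T+\Big(\frac{(n\sigma^2\|C\|_2^2)^{1/3}\,T\,S_T^{2/3}}{\underline\lambda^{2/3}}+\frac{n\sigma^2\|C\|_2^2\,T^2}{\underline\lambda^2}\Big)\log\frac1\delta\Big).$$ -/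

import Mathlib

open MeasureTheory ProbabilityTheory
open scoped NNReal Kronecker Matrix

noncomputable section

/-- An orientation of the edges of `G`: every edge gets a tail and a head. -/
structure EdgeOrientation {V : Type*} (G : SimpleGraph V) where
  tail : G.edgeSet → V
  head : G.edgeSet → V
  edge_eq : ∀ e : G.edgeSet, (e : Sym2 V) = s(tail e, head e)

/-- The incidence matrix `D ∈ {0, -1, +1}^{|E| × |V|}` of an oriented graph. -/
def incidenceMat {V : Type*} [DecidableEq V] {G : SimpleGraph V} (o : EdgeOrientation G) :
    Matrix G.edgeSet V ℝ :=
  Matrix.of fun e t => if t = o.head e then 1 else if t = o.tail e then -1 else 0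

/-- The matrix `M = D ⊗ I_n`. -/
def smoothnessMat {V : Type*} [DecidableEq V] {G : SimpleGraph V} (o : EdgeOrientation G)
    (n : ℕ) : Matrix (G.edgeSet × Fin n) (V × Fin n) ℝ :=
  incidenceMat o ⊗ₖ (1 : Matrix (Fin n) (Fin n) ℝ)

/-- The block-diagonal design matrix `C = diag(C_1, …, C_T)`, of size `(∑ m_t) × (T n)`. -/
def blockDiagMat {T n : ℕ} {m : Fin T → ℕ} (C : (t : Fin T) → Matrix (Fin (m t)) (Fin n) ℝ) :
    Matrix (Σ t, Fin (m t)) (Fin T × Fin n) ℝ :=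
  Matrix.of fun i p => if i.1 = p.1 then C i.1 i.2 p.2 else 0

/-- The stacked matrix `O_T = [C_1ᵀ ⋯ C_Tᵀ]ᵀ`, of size `(∑ m_t) × n`. -/
def stackedMat {T n : ℕ} {m : Fin T → ℕ} (C : (t : Fin T) → Matrix (Fin (m t)) (Fin n) ℝ) :
    Matrix (Σ t, Fin (m t)) (Fin n) ℝ :=
  Matrix.of fun i j => C i.1 i.2 j

theorem isHermitian_gram {m n : Type*} [Fintype m] (A : Matrix m n ℝ) :
    (Aᵀ * A).IsHermitian := by
  simpa using Matrix.isHermitian_conjTranspose_mul_self A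

/-- Smallest eigenvalue of a real symmetric matrix. -/
def minEigenvalue {n : Type*} [Fintype n] [DecidableEq n] {A : Matrix n n ℝ}
    (hA : A.IsHermitian) : ℝ := ⨅ i, hA.eigenvalues i

/-- Largest eigenvalue of a real symmetric matrix. -/
def maxEigenvalue {n : Type*} [Fintype n] [DecidableEq n] {A : Matrix n n ℝ}
    (hA : A.IsHermitian) : ℝ := ⨆ i, hA.eigenvalues i

open scoped Matrix.Norms.L2Operator in
/-- Spectral norm `‖A‖₂`: the operator norm with respect to Euclidean norms, i.e. the largest
singular value. -/
def matSpectralNorm {m n : Type*} [Fintype m] [Fintype n] [DecidableEq n]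
    (A : Matrix m n ℝ) : ℝ := ‖A‖

/-- A random vector `Y` is `σ`-subgaussian if `E exp(s uᵀY) ≤ exp(s² σ² / 2)` for all real `s` and
all unit vectors `u`, the expectations being finite. (This forces `Y` to be centered.) -/
def IsSubgaussianVector {Ω ι : Type*} [MeasurableSpace Ω] [Fintype ι]
    (Y : Ω → EuclideanSpace ℝ ι) (σ : ℝ≥0) (P : Measure Ω) : Prop :=
  ∀ u : EuclideanSpace ℝ ι, ‖u‖ = 1 → HasSubgaussianMGF (fun ω => inner ℝ u (Y ω)) (σ ^ 2) P

/-- The objective `½ ‖y - C z‖² + (μ / 2) ‖M z‖²`. -/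
def penalizedObjective {k l p : Type*} [Fintype k] [Fintype l] [Fintype p] [DecidableEq p]
    (C : Matrix k p ℝ) (M : Matrix l p ℝ) (μ : ℝ) (y : EuclideanSpace ℝ k)
    (z : EuclideanSpace ℝ p) : ℝ :=
  1 / 2 * ‖y - Matrix.toEuclideanLin C z‖ ^ 2 + μ / 2 * ‖Matrix.toEuclideanLin M z‖ ^ 2

/-- `xhat` is a penalized least squares estimate, i.e. a minimizer of the objective. -/
def IsPenalizedLS {k l p : Type*} [Fintype k] [Fintype l] [Fintype p] [DecidableEq p]
    (C : Matrix k p ℝ) (M : Matrix l p ℝ) (μ : ℝ) (y : EuclideanSpace ℝ k)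
    (xhat : EuclideanSpace ℝ p) : Prop :=
  ∀ z, penalizedObjective C M μ y xhat ≤ penalizedObjective C M μ y z

/-- The regularization parameter `μ*` for the star graph. Arguments: the constant `c₁`, the noise
level `σ`, the norm `normC = ‖C‖₂`, the bounds `lo ≤ λ_min(O_Tᵀ O_T)`, `λ_max(O_Tᵀ O_T) ≤ up`, and
the smoothness level `S`. -/
def muStar (c₁ : ℝ) (n T : ℕ) (σ normC lo up S : ℝ) : ℝ :=
  max ((2 * n * σ ^ 2 * normC ^ 2) ^ (1 / 3 : ℝ) * (lo ^ (1 / 3 : ℝ) / S ^ (1 / 3 : ℝ)) - lo / T)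
    (c₁ * (lo / T + normC ^ 2 * (up / lo)))

/-- The right-hand side of the error bound for the star graph, without the constant factor. -/
def starErrorBound (n T : ℕ) (σ normC lo up S δ : ℝ) : ℝ :=
  S + normC ^ 2 * (up / lo ^ 2) * T * S
    + ((n * σ ^ 2 * normC ^ 2) ^ (1 / 3 : ℝ) * T * S ^ (2 / 3 : ℝ) / lo ^ (2 / 3 : ℝ)
        + n * σ ^ 2 * normC ^ 2 * T ^ 2 / lo ^ 2) * Real.log (1 / δ)

end

/-! Write `A`, `M` for the operators of the block-diagonal and smoothness matrices, `c` for the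
spectral norm of `A`, and `P` for the projection onto signals constant in time. These are killed by
`M`, and on them `A` acts as the stacked matrix scaled by `1/√T`, so `‖A e‖² ≥ (lo/T)‖e‖²`. On their
orthogonal complement `‖M e‖ ≥ ‖e‖`, by the spectral gap of the star. As `μ ≥ lo/T + c²`, the form
`‖A e‖² + μ‖M e‖²` dominates `(lo/2T)‖e‖²` (`coercive_penalized`).

The optimality condition is linear, so `xhat - x` splits into a deterministic bias `b` and a noise
part `e`. Testing the bias equation with `b` gives `‖b‖² ≤ 2μTS/lo` (`norm_sq_bias_le`). For the
noise, the `n` coordinates of `P e` are linear functionals of `η` of norm at most `2cT/lo`; the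
remaining directions cost only `‖Aᵀη‖²/μ²` plus a multiple of `‖P e‖²` (`norm_sq_noise_le`). The
bound is thus a quadratic form in `η`, which concentrates by `one_sub_le_measureReal_sum_sq_le`.

The bias grows with `μ` while `nTσ²c²/μ²` decreases; `muStar` balances them
(`starErrorBound_bound`). -/

/-! ### Deterministic bounds for penalized least squares. -/

section Deterministic

variable {E F G : Type*} [NormedAddCommGroup E] [InnerProductSpace ℝ E]
  [NormedAddCommGroup F] [InnerProductSpace ℝ F] [NormedAddCommGroup G] [InnerProductSpace ℝ G]

/-- The orthogonal projection onto the span of a finite orthonormal family. -/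
def projSpan {ι : Type*} [Fintype ι] (p : ι → E) (e : E) : E := ∑ j, inner ℝ (p j) e • p j

theorem norm_sq_sum_smul {ι : Type*} [Fintype ι] {p : ι → E} (hp : Orthonormal ℝ p) (v : ι → ℝ) :
    ‖∑ j, v j • p j‖ ^ 2 = ∑ j, v j ^ 2 := by
  rw [← real_inner_self_eq_norm_sq, hp.inner_sum]
  simp [sq]

theorem norm_sq_projSpan {ι : Type*} [Fintype ι] {p : ι → E} (hp : Orthonormal ℝ p) (e : E) :
    ‖projSpan p e‖ ^ 2 = ∑ j, inner ℝ (p j) e ^ 2 :=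
  norm_sq_sum_smul hp _

theorem inner_projSpan_sub {ι : Type*} [Fintype ι] {p : ι → E} (hp : Orthonormal ℝ p) (e : E)
    (v : ι → ℝ) : inner ℝ (∑ j, v j • p j) (e - projSpan p e) = 0 := by
  rw [inner_sub_right, projSpan, hp.inner_sum, sum_inner, sub_eq_zero]
  simp [real_inner_smul_left]

theorem norm_sq_eq_projSpan_add {ι : Type*} [Fintype ι] {p : ι → E} (hp : Orthonormal ℝ p)
    (e : E) : ‖e‖ ^ 2 = ‖projSpan p e‖ ^ 2 + ‖e - projSpan p e‖ ^ 2 := by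
  have h := inner_projSpan_sub hp e (fun j => inner ℝ (p j) e)
  have h2 := norm_add_sq_real (projSpan p e) (e - projSpan p e)
  rw [add_sub_cancel] at h2
  change inner ℝ (projSpan p e) (e - projSpan p e) = 0 at h
  rw [h2, h]; ring

theorem norm_sub_projSpan_le {ι : Type*} [Fintype ι] {p : ι → E} (hp : Orthonormal ℝ p) (e : E)
    (v : ι → ℝ) : ‖e - projSpan p e‖ ^ 2 ≤ ‖e - ∑ j, v j • p j‖ ^ 2 := by
  have h := inner_projSpan_sub hp e (fun j => inner ℝ (p j) e - v j)
  have h3 : ∑ j, (inner ℝ (p j) e - v j) • p j = projSpan p e - ∑ j, v j • p j := by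
    simp [projSpan, sub_smul]
  rw [h3] at h
  have h2 := norm_add_sq_real (projSpan p e - ∑ j, v j • p j) (e - projSpan p e)
  rw [h, show projSpan p e - ∑ j, v j • p j + (e - projSpan p e) = e - ∑ j, v j • p j by abel] at h2
  nlinarith [sq_nonneg ‖projSpan p e - ∑ j, v j • p j‖]

/-- Coercivity of the penalized quadratic form. -/
theorem coercive_penalized {ι : Type*} [Fintype ι] {p : ι → E} (hp : Orthonormal ℝ p)
    (A : E →ₗ[ℝ] F) (M : E →ₗ[ℝ] G) {c κ μ : ℝ}
    (hμ : κ + c ^ 2 ≤ μ) (hκ : 0 ≤ κ) (hA : ∀ e, ‖A e‖ ≤ c * ‖e‖)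
    (hM : ∀ e, ‖e - projSpan p e‖ ^ 2 ≤ ‖M e‖ ^ 2)
    (hAp : ∀ e, κ * ‖projSpan p e‖ ^ 2 ≤ ‖A (projSpan p e)‖ ^ 2) (e : E) :
    κ / 2 * ‖e‖ ^ 2 ≤ ‖A e‖ ^ 2 + μ * ‖M e‖ ^ 2 := by
  have h1 := norm_sq_eq_projSpan_add hp e
  have h2 : ‖A (projSpan p e)‖ ≤ ‖A e‖ + ‖A (e - projSpan p e)‖ := by
    have := norm_sub_le (A e) (A (e - projSpan p e))
    rwa [← map_sub, sub_sub_cancel] at this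
  have h3 := hA (e - projSpan p e)
  have h4 : ‖A (projSpan p e)‖ ^ 2 ≤ 2 * ‖A e‖ ^ 2 + 2 * c ^ 2 * ‖e - projSpan p e‖ ^ 2 := by
    have h5 : ‖A (projSpan p e)‖ ≤ ‖A e‖ + c * ‖e - projSpan p e‖ := by linarith
    have := pow_le_pow_left₀ (norm_nonneg _) h5 2
    nlinarith [sq_nonneg (‖A e‖ - c * ‖e - projSpan p e‖)]
  -- The `c²` in `μ` pays for the leakage of `A` off the span in `h4`, the `κ` for the coercivity
  -- off the span itself.
  have h6 : (κ + c ^ 2) * ‖e - projSpan p e‖ ^ 2 ≤ μ * ‖M e‖ ^ 2 :=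
    mul_le_mul hμ (hM e) (by positivity) (by nlinarith [sq_nonneg c])
  nlinarith [hAp e, mul_nonneg hκ (sq_nonneg ‖e - projSpan p e‖)]

/-- Coercivity makes the normal operator injective, hence surjective in finite dimension. Solutions
serve both as the bias vector and as dual vectors for the coordinates of the noise error. -/
theorem exists_penalized_solution [FiniteDimensional ℝ E] [FiniteDimensional ℝ F]
    [FiniteDimensional ℝ G]
    (A : E →ₗ[ℝ] F) (M : E →ₗ[ℝ] G) {κ μ : ℝ} (hκ : 0 < κ)
    (hco : ∀ e, κ * ‖e‖ ^ 2 ≤ ‖A e‖ ^ 2 + μ * ‖M e‖ ^ 2) (w : E) :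
    ∃ g, ∀ d, inner ℝ (A d) (A g) + μ * inner ℝ (M d) (M g) = inner ℝ d w := by
  let H : E →ₗ[ℝ] E := A.adjoint ∘ₗ A + μ • (M.adjoint ∘ₗ M)
  have hH : ∀ d g, inner ℝ d (H g) = inner ℝ (A d) (A g) + μ * inner ℝ (M d) (M g) := by
    intro d g
    simp [H, inner_add_right, real_inner_smul_right, LinearMap.adjoint_inner_right]
  have hinj : Function.Injective H := by
    rw [injective_iff_map_eq_zero]
    intro a ha
    have h := hH a a
    rw [ha, inner_zero_right, real_inner_self_eq_norm_sq, real_inner_self_eq_norm_sq] at h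
    have h1 := hco a
    rw [← h] at h1
    have : ‖a‖ ^ 2 ≤ 0 := by nlinarith [sq_nonneg ‖a‖]
    simpa using le_antisymm this (sq_nonneg _)
  obtain ⟨g, hg⟩ := (LinearMap.injective_iff_surjective.mp hinj) w
  exact ⟨g, fun d => by rw [← hH, hg]⟩

theorem norm_penalized_solution_le
    (A : E →ₗ[ℝ] F) (M : E →ₗ[ℝ] G) {κ μ : ℝ} (hκ : 0 < κ)
    (hco : ∀ e, κ * ‖e‖ ^ 2 ≤ ‖A e‖ ^ 2 + μ * ‖M e‖ ^ 2) {w g : E}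
    (hg : ∀ d, inner ℝ (A d) (A g) + μ * inner ℝ (M d) (M g) = inner ℝ d w) :
    ‖g‖ ≤ ‖w‖ / κ := by
  rw [le_div_iff₀ hκ]
  have h := hg g
  rw [real_inner_self_eq_norm_sq, real_inner_self_eq_norm_sq] at h
  have h1 := hco g
  have h2 := real_inner_le_norm g w
  rcases (norm_nonneg g).eq_or_lt with h0 | h0
  · rw [← h0]; simp
  · nlinarith

/-- Testing with `d = b` gives `‖M b‖ ≤ ‖M x‖`; putting this back keeps the bound linear in `μ`,
which the final trade-off needs. -/
theorem norm_sq_bias_le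
    (A : E →ₗ[ℝ] F) (M : E →ₗ[ℝ] G) {κ μ : ℝ} (hκ : 0 < κ) (hμ : 0 < μ)
    (hco : ∀ e, κ * ‖e‖ ^ 2 ≤ ‖A e‖ ^ 2 + μ * ‖M e‖ ^ 2) {x b : E}
    (hb : ∀ d, inner ℝ (A d) (A b) + μ * inner ℝ (M d) (M b) = -(μ * inner ℝ (M d) (M x))) :
    ‖b‖ ^ 2 ≤ μ * ‖M x‖ ^ 2 / κ := by
  rw [le_div_iff₀ hκ]
  have h := hb b
  rw [real_inner_self_eq_norm_sq, real_inner_self_eq_norm_sq] at h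
  have h1 := hco b
  have h2 := neg_le_of_abs_le (abs_real_inner_le_norm (M b) (M x))
  have h3 : ‖M b‖ ^ 2 ≤ ‖M b‖ * ‖M x‖ := by
    have : μ * ‖M b‖ ^ 2 ≤ μ * (‖M b‖ * ‖M x‖) := by
      nlinarith [sq_nonneg ‖A b‖, mul_le_mul_of_nonneg_left h2 hμ.le]
    exact le_of_mul_le_mul_left this hμ
  have h4 : ‖M b‖ * ‖M x‖ ≤ ‖M x‖ ^ 2 := by
    rcases (norm_nonneg (M b)).eq_or_lt with h0 | h0
    · rw [← h0]; simp
    · have : ‖M b‖ ≤ ‖M x‖ := by nlinarith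
      nlinarith [norm_nonneg (M x)]
  nlinarith [mul_le_mul_of_nonneg_left h2 hμ.le, mul_le_mul_of_nonneg_left h4 hμ.le]

/-- The stochastic error, in terms of the linear functionals `⟨A (g j), η⟩` and `⟨A (b i), η⟩`. -/
theorem norm_sq_noise_le {ι ι' : Type*} [Fintype ι] [Fintype ι'] {p : ι → E}
    (hp : Orthonormal ℝ p) (b : OrthonormalBasis ι' ℝ E)
    (A : E →ₗ[ℝ] F) (M : E →ₗ[ℝ] G) {c μ : ℝ} (hc : 0 ≤ c) (hμ0 : 0 < μ)
    (hμ : c ^ 2 ≤ μ) (hA : ∀ e, ‖A e‖ ≤ c * ‖e‖)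
    (hM : ∀ e, ‖e - projSpan p e‖ ^ 2 ≤ ‖M e‖ ^ 2) (hMp : ∀ e, M (projSpan p e) = 0)
    {g : ι → E}
    (hg : ∀ j d, inner ℝ (A d) (A (g j)) + μ * inner ℝ (M d) (M (g j)) = inner ℝ d (p j))
    {η : F} {e : E}
    (he : ∀ d, inner ℝ (A d) (A e) + μ * inner ℝ (M d) (M e) = inner ℝ (A d) η) :
    ‖e‖ ^ 2 ≤ 3 * ∑ j, inner ℝ (A (g j)) η ^ 2 + 2 / μ ^ 2 * ∑ i, inner ℝ (A (b i)) η ^ 2 := by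
  -- Duality: by symmetry of the form, testing the equation of `e` with `g j` and that of `g j` with
  -- `e` gives `⟨p j, e⟩ = ⟨A (g j), η⟩`.
  have h1 : ‖projSpan p e‖ ^ 2 = ∑ j, inner ℝ (A (g j)) η ^ 2 := by
    rw [norm_sq_projSpan hp]
    refine Finset.sum_congr rfl fun j _ => ?_
    rw [← he (g j), real_inner_comm, ← hg j e, real_inner_comm (A e), real_inner_comm (M e)]
  set u := e - projSpan p e with hu
  set R := ∑ i, inner ℝ (A (b i)) η ^ 2 with hR
  have hR0 : 0 ≤ R := Finset.sum_nonneg fun i _ => sq_nonneg _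
  -- `R` is `‖Aᵀη‖²` computed in the basis `b`, so this is Cauchy–Schwarz.
  have h2 : inner ℝ (A u) η ≤ ‖u‖ * √R := by
    have hsum : inner ℝ (A u) η = ∑ i, inner ℝ (b i) u * inner ℝ (A (b i)) η := by
      conv_lhs => rw [← b.sum_repr' u]
      simp [map_sum, sum_inner, real_inner_smul_left]
    rw [hsum, show ‖u‖ = √(∑ i, inner ℝ (b i) u ^ 2) by
      rw [← Real.sqrt_sq (norm_nonneg u), ← b.sum_sq_norm_inner_right u]; simp]
    exact Real.sum_mul_le_sqrt_mul_sqrt _ _ _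
  have hMu : M u = M e := by rw [hu, map_sub, hMp, sub_zero]
  have h3 := he u
  rw [hMu, real_inner_self_eq_norm_sq] at h3
  have hAe : A e = A u + A (projSpan p e) := by rw [← map_add, hu, sub_add_cancel]
  rw [hAe, inner_add_right, real_inner_self_eq_norm_sq] at h3
  have h4 : -(c ^ 2 * ‖u‖ * ‖projSpan p e‖) ≤ inner ℝ (A u) (A (projSpan p e)) := by
    have h5 := neg_le_of_abs_le (abs_real_inner_le_norm (A u) (A (projSpan p e)))
    have := mul_le_mul (hA u) (hA (projSpan p e)) (norm_nonneg _) (by positivity)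
    nlinarith
  -- From testing with `u`: `‖A u‖²` is dropped, `hM` bounds `‖u‖` by `‖M e‖`, and `c² ≤ μ` controls
  -- the cross term.
  have h5 : μ * ‖u‖ ≤ √R + μ * ‖projSpan p e‖ := by
    rcases (norm_nonneg u).eq_or_lt with h0 | h0
    · rw [← h0]; simp; positivity
    · have h6 := mul_le_mul_of_nonneg_left (hM e) hμ0.le
      have h7 : c ^ 2 * ‖u‖ * ‖projSpan p e‖ ≤ μ * ‖u‖ * ‖projSpan p e‖ := by gcongr
      have h8 : ‖u‖ * (μ * ‖u‖) ≤ ‖u‖ * (√R + μ * ‖projSpan p e‖) := by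
        nlinarith [sq_nonneg ‖A u‖]
      exact le_of_mul_le_mul_left h8 h0
  have h6 : ‖u‖ ≤ √R / μ + ‖projSpan p e‖ := by
    rw [div_add' _ _ _ hμ0.ne', le_div_iff₀ hμ0]; linarith
  have h7 : ‖u‖ ^ 2 ≤ 2 / μ ^ 2 * R + 2 * ‖projSpan p e‖ ^ 2 := by
    have h8 := pow_le_pow_left₀ (norm_nonneg _) h6 2
    have h9 : (√R / μ) ^ 2 = R / μ ^ 2 := by rw [div_pow, Real.sq_sqrt hR0]
    have h10 : 2 / μ ^ 2 * R = 2 * (R / μ ^ 2) := by ring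
    nlinarith [sq_nonneg (√R / μ - ‖projSpan p e‖)]
  rw [norm_sq_eq_projSpan_add hp e, ← h1]
  linarith

/-- First-order optimality: a quadratic that is minimal at `0` has no linear term. -/
theorem eq_zero_of_quadratic_nonneg {a b : ℝ} (h : ∀ t : ℝ, 0 ≤ t * a + t ^ 2 * b) : a = 0 := by
  have h1 := discrim_le_zero (a := b) (b := a) (c := 0) fun t => by nlinarith [h t]
  have : a ^ 2 ≤ 0 := by simpa [discrim] using h1
  simpa using le_antisymm this (sq_nonneg a)

end Deterministic

/-! ### Exponential moments and tails of quadratic forms in a subgaussian vector. -/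

section Subgaussian

theorem lintegral_exp_sq_div_four_gaussianReal :
    ∫⁻ g, ENNReal.ofReal (Real.exp (g ^ 2 / 4)) ∂(gaussianReal 0 1) = ENNReal.ofReal √2 := by
  rw [gaussianReal_of_var_ne_zero _ one_ne_zero,
    lintegral_withDensity_eq_lintegral_mul _ (measurable_gaussianPDF _ _) (by fun_prop)]
  have h : ∀ g : ℝ, (gaussianPDF 0 1 * fun g => ENNReal.ofReal (Real.exp (g ^ 2 / 4))) g
      = ENNReal.ofReal ((√(2 * Real.pi))⁻¹ * Real.exp (-(1 / 4) * g ^ 2)) := by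
    intro g
    simp only [Pi.mul_apply, gaussianPDF, gaussianPDFReal]
    rw [← ENNReal.ofReal_mul (by positivity), mul_assoc, ← Real.exp_add]
    congr 2
    · simp
    · congr 1; push_cast; ring
  simp_rw [h]
  rw [← ofReal_integral_eq_lintegral_ofReal, integral_const_mul, integral_gaussian]
  · congr 1
    rw [show Real.pi / (1 / 4) = 2 * (2 * Real.pi) by ring,
      Real.sqrt_mul zero_le_two (2 * Real.pi)]
    have : √(2 * Real.pi) ≠ 0 := by positivity
    rw [mul_comm, mul_assoc, mul_inv_cancel₀ this, mul_one]
  · exact (integrable_exp_neg_mul_sq (by norm_num)).const_mul _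
  · exact Filter.Eventually.of_forall fun g => by positivity

/-- Gaussian linearization: `exp (a x²)` is the mean of `exp (√(2a) x g)` over a standard normal
`g`. After Tonelli, the subgaussian bound in `x` leaves `exp (a v g²) = exp (g²/4)`. -/
theorem lintegral_exp_mul_sq_le_of_id {ν : Measure ℝ} [IsProbabilityMeasure ν] {v : ℝ≥0}
    (h : HasSubgaussianMGF id v ν) {a : ℝ} (ha : 0 ≤ a) (hav : 4 * a * v = 1) :
    ∫⁻ x, ENNReal.ofReal (Real.exp (a * x ^ 2)) ∂ν ≤ ENNReal.ofReal √2 := by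
  set s := √(2 * a) with hs
  have hs2 : s ^ 2 = 2 * a := Real.sq_sqrt (by positivity)
  have h1 : ∀ x : ℝ, ENNReal.ofReal (Real.exp (a * x ^ 2))
      = ∫⁻ g, ENNReal.ofReal (Real.exp (s * x * g)) ∂(gaussianReal 0 1) := by
    intro x
    rw [← ofReal_integral_eq_lintegral_ofReal (integrable_exp_mul_gaussianReal _)
      (Filter.Eventually.of_forall fun g => (Real.exp_pos _).le)]
    have := congrFun (mgf_id_gaussianReal (μ := 0) (v := 1)) (s * x)
    simp only [mgf, id] at this
    rw [this]
    congr 2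
    push_cast
    linear_combination -(x ^ 2 / 2) * hs2
  simp_rw [h1]
  rw [lintegral_lintegral_swap (by fun_prop), ← lintegral_exp_sq_div_four_gaussianReal]
  refine lintegral_mono fun g => ?_
  have h2 : ∀ x : ℝ, s * x * g = s * g * id x := fun x => by simp; ring
  simp_rw [h2]
  rw [← ofReal_integral_eq_lintegral_ofReal (h.integrable_exp_mul _)
      (Filter.Eventually.of_forall fun g => (Real.exp_pos _).le)]
  refine ENNReal.ofReal_le_ofReal ((h.mgf_le (s * g)).trans_eq ?_)
  congr 1
  linear_combination (v : ℝ) * g ^ 2 / 2 * hs2 + g ^ 2 / 4 * hav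

theorem lintegral_exp_mul_sq_le {Ω : Type*} [MeasurableSpace Ω] {P : Measure Ω}
    [IsProbabilityMeasure P] {X : Ω → ℝ} {v : ℝ≥0} (h : HasSubgaussianMGF X v P) {a : ℝ}
    (ha : 0 ≤ a) (hav : 4 * a * v = 1) :
    ∫⁻ ω, ENNReal.ofReal (Real.exp (a * X ω ^ 2)) ∂P ≤ ENNReal.ofReal √2 := by
  have hm := h.aemeasurable
  have : IsProbabilityMeasure (P.map X) := Measure.isProbabilityMeasure_map hm
  have h2 := lintegral_exp_mul_sq_le_of_id ((HasSubgaussianMGF.id_map_iff hm).mpr h) ha hav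
  rwa [lintegral_map' (by fun_prop) hm] at h2

variable {Ω ι κ : Type*} [MeasurableSpace Ω] [Fintype ι] [Fintype κ] {P : Measure Ω}
  {Y : Ω → EuclideanSpace ℝ ι} {σ : ℝ≥0}

theorem IsSubgaussianVector.aemeasurable_inner (h : IsSubgaussianVector Y σ P)
    (a : EuclideanSpace ℝ ι) : AEMeasurable (fun ω => inner ℝ a (Y ω)) P := by
  rcases eq_or_ne a 0 with rfl | ha
  · simp
  · have h1 := (h (‖a‖⁻¹ • a) (norm_smul_inv_norm ha)).aemeasurable.const_mul ‖a‖
    refine h1.congr (Filter.Eventually.of_forall fun ω => ?_)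
    simp only [real_inner_smul_left]
    rw [mul_inv_cancel_left₀ (norm_ne_zero_iff.mpr ha)]

/-- Jensen with weights `‖a k‖² / V` reduces to single unit directions, so no independence between
them is needed. -/
theorem IsSubgaussianVector.lintegral_exp_sum_sq_le [IsProbabilityMeasure P]
    (h : IsSubgaussianVector Y σ P)
    (hσ : 0 < σ) (a : κ → EuclideanSpace ℝ ι) {V : ℝ} (hV : 0 < V)
    (ha : ∑ k, ‖a k‖ ^ 2 = V) :
    ∫⁻ ω, ENNReal.ofReal (Real.exp (1 / (4 * σ ^ 2 * V) * ∑ k, inner ℝ (a k) (Y ω) ^ 2)) ∂P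
      ≤ ENNReal.ofReal √2 := by
  have hσ' : (0 : ℝ) < σ := hσ
  have hw : ∑ k, ‖a k‖ ^ 2 / V = 1 := by
    rw [← Finset.sum_div, ha, div_self hV.ne']
  have h1 : ∀ ω, Real.exp (1 / (4 * σ ^ 2 * V) * ∑ k, inner ℝ (a k) (Y ω) ^ 2) ≤
      ∑ k, ‖a k‖ ^ 2 / V * Real.exp (1 / (4 * σ ^ 2) * inner ℝ (‖a k‖⁻¹ • a k) (Y ω) ^ 2) := by
    intro ω
    have := convexOn_exp.map_sum_le (t := Finset.univ) (w := fun k => ‖a k‖ ^ 2 / V)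
      (p := fun k => 1 / (4 * (σ : ℝ) ^ 2) * inner ℝ (‖a k‖⁻¹ • a k) (Y ω) ^ 2)
      (fun k _ => by positivity) hw (fun k _ => Set.mem_univ _)
    simp only [smul_eq_mul] at this
    refine le_of_eq_of_le (congrArg Real.exp ?_) this
    rw [Finset.mul_sum]
    refine Finset.sum_congr rfl fun k _ => ?_
    rcases eq_or_ne (a k) 0 with h0 | h0
    · simp [h0]
    · have := norm_ne_zero_iff.mpr h0
      rw [real_inner_smul_left]
      field_simp
  have hmeas : ∀ k, AEMeasurable (fun ω => ENNReal.ofReal (‖a k‖ ^ 2 / V) *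
      ENNReal.ofReal (Real.exp (1 / (4 * σ ^ 2) * inner ℝ (‖a k‖⁻¹ • a k) (Y ω) ^ 2))) P := by
    intro k
    have := h.aemeasurable_inner (‖a k‖⁻¹ • a k)
    fun_prop
  calc _ ≤ ∫⁻ ω, ∑ k, ENNReal.ofReal (‖a k‖ ^ 2 / V) *
        ENNReal.ofReal (Real.exp (1 / (4 * σ ^ 2) * inner ℝ (‖a k‖⁻¹ • a k) (Y ω) ^ 2)) ∂P := by
        refine lintegral_mono fun ω => (ENNReal.ofReal_le_ofReal (h1 ω)).trans_eq ?_
        rw [ENNReal.ofReal_sum_of_nonneg fun k _ => by positivity]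
        exact Finset.sum_congr rfl fun k _ => ENNReal.ofReal_mul (by positivity)
    _ = ∑ k, ENNReal.ofReal (‖a k‖ ^ 2 / V) * ∫⁻ ω,
        ENNReal.ofReal (Real.exp (1 / (4 * σ ^ 2) * inner ℝ (‖a k‖⁻¹ • a k) (Y ω) ^ 2)) ∂P := by
        rw [lintegral_finsetSum' _ fun k _ => hmeas k]
        exact Finset.sum_congr rfl fun k _ => lintegral_const_mul' _ _ ENNReal.ofReal_ne_top
    _ ≤ ∑ k, ENNReal.ofReal (‖a k‖ ^ 2 / V) * ENNReal.ofReal √2 := by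
        refine Finset.sum_le_sum fun k _ => ?_
        rcases eq_or_ne (a k) 0 with h0 | h0
        · simp [h0]
        · gcongr
          refine lintegral_exp_mul_sq_le (h _ (norm_smul_inv_norm h0)) (by positivity) ?_
          push_cast
          field_simp
    _ = ENNReal.ofReal √2 := by
        rw [← Finset.sum_mul, ← ENNReal.ofReal_sum_of_nonneg fun k _ => by positivity, hw]
        simp

theorem IsSubgaussianVector.ae_inner_eq_zero (h : IsSubgaussianVector Y 0 P)
    (a : EuclideanSpace ℝ ι) : ∀ᵐ ω ∂P, inner ℝ a (Y ω) = 0 := by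
  rcases eq_or_ne a 0 with rfl | ha
  · simp
  · have h1 := h (‖a‖⁻¹ • a) (norm_smul_inv_norm ha)
    rw [zero_pow two_ne_zero] at h1
    filter_upwards [h1.ae_eq_zero_of_hasSubgaussianMGF_zero] with ω hω
    simpa [real_inner_smul_left, ha] using hω

/-- Concentration of a nonnegative quadratic form of a subgaussian vector. -/
theorem IsSubgaussianVector.one_sub_le_measureReal_sum_sq_le [IsProbabilityMeasure P]
    (h : IsSubgaussianVector Y σ P)
    (a : κ → EuclideanSpace ℝ ι) {V : ℝ} (ha : ∑ k, ‖a k‖ ^ 2 ≤ V) {δ : ℝ} (hδ0 : 0 < δ)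
    (hδ : δ < Real.exp (-1)) :
    1 - δ ≤ P.real {ω | ∑ k, inner ℝ (a k) (Y ω) ^ 2 ≤ 8 * σ ^ 2 * V * Real.log (1 / δ)} := by
  have hlog : 1 < Real.log (1 / δ) := by
    rw [one_div, Real.log_inv, lt_neg, Real.log_lt_iff_lt_exp hδ0]; exact hδ
  have hW0 : 0 ≤ ∑ k, ‖a k‖ ^ 2 := Finset.sum_nonneg fun k _ => sq_nonneg _
  have hae : (σ = 0 ∨ ∑ k, ‖a k‖ ^ 2 = 0) → ∀ᵐ ω ∂P, ∑ k, inner ℝ (a k) (Y ω) ^ 2 = 0 := by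
    rintro (rfl | h0)
    · filter_upwards [ae_all_iff.mpr fun k => h.ae_inner_eq_zero (a k)] with ω hω
      simp [hω]
    · rw [Finset.sum_eq_zero_iff_of_nonneg fun k _ => sq_nonneg _] at h0
      refine Filter.Eventually.of_forall fun ω => Finset.sum_eq_zero fun k hk => ?_
      have : a k = 0 := by simpa using h0 k hk
      simp [this]
  -- In the degenerate cases the rate `1 / (4σ²W)` is meaningless, but the form vanishes almost
  -- surely.
  by_cases hdeg : σ = 0 ∨ ∑ k, ‖a k‖ ^ 2 = 0
  · have h1 : P {ω | ∑ k, inner ℝ (a k) (Y ω) ^ 2 ≤ 8 * σ ^ 2 * V * Real.log (1 / δ)} = 1 := by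
      rw [← measure_univ (μ := P)]
      refine measure_congr (Filter.eventuallyEq_univ.mpr ?_)
      filter_upwards [hae hdeg] with ω hω
      have : 0 ≤ V := hW0.trans ha
      have : 0 ≤ Real.log (1 / δ) := by linarith
      simp only [hω]
      positivity
    rw [measureReal_def, h1]
    simp [hδ0.le]
  push Not at hdeg
  have hσ : 0 < σ := pos_iff_ne_zero.mpr hdeg.1
  have hσ' : (0 : ℝ) < σ := hσ
  have hW : 0 < ∑ k, ‖a k‖ ^ 2 := lt_of_le_of_ne hW0 (Ne.symm hdeg.2)
  set W := ∑ k, ‖a k‖ ^ 2 with hWdef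
  set Q : Ω → ℝ := fun ω => ∑ k, inner ℝ (a k) (Y ω) ^ 2 with hQ
  have hQm : AEMeasurable Q P :=
    Finset.aemeasurable_fun_sum _ fun k _ => (h.aemeasurable_inner (a k)).pow_const 2
  set t := 8 * σ ^ 2 * V * Real.log (1 / δ) with ht
  have htail : P.real {ω | t < Q ω} ≤ δ := by
    have h1 := h.lintegral_exp_sum_sq_le hσ a hW rfl
    -- Markov at level `exp (2 log (1/δ)) = δ⁻²` gives a tail of `√2 δ²`, which is at most `δ`
    -- because `δ < e⁻¹`.
    have h2 := mul_meas_ge_le_lintegral₀ (μ := P)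
      (f := fun ω => ENNReal.ofReal (Real.exp (1 / (4 * σ ^ 2 * W) * Q ω))) (by fun_prop)
      (ENNReal.ofReal (Real.exp (2 * Real.log (1 / δ))))
    have h3 : {ω | t < Q ω} ⊆ {ω | ENNReal.ofReal (Real.exp (2 * Real.log (1 / δ))) ≤
        ENNReal.ofReal (Real.exp (1 / (4 * σ ^ 2 * W) * Q ω))} := by
      intro ω hω
      refine ENNReal.ofReal_le_ofReal (Real.exp_le_exp.mpr ?_)
      rw [div_mul_eq_mul_div, one_mul, le_div_iff₀ (by positivity)]
      have h4 : 8 * σ ^ 2 * W * Real.log (1 / δ) ≤ t := by rw [ht]; gcongr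
      have h5 : t < Q ω := hω
      linarith
    have h4 : ENNReal.ofReal (Real.exp (2 * Real.log (1 / δ))) * P {ω | t < Q ω}
        ≤ ENNReal.ofReal √2 := ((mul_le_mul_right (measure_mono h3) _).trans h2).trans h1
    rw [← ofReal_measureReal, ← ENNReal.ofReal_mul (by positivity),
      ENNReal.ofReal_le_ofReal_iff (by positivity)] at h4
    have h5 : Real.exp (2 * Real.log (1 / δ)) = 1 / δ ^ 2 := by
      rw [two_mul, Real.exp_add, Real.exp_log (by positivity)]; field_simp
    rw [h5, one_div, inv_mul_le_iff₀ (by positivity)] at h4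
    have h6 : √2 * δ ≤ 1 := by
      have : √2 ≤ Real.exp 1 := by
        have := Real.exp_one_gt_d9
        have : √2 ≤ 2 := Real.sqrt_le_iff.mpr (by norm_num)
        linarith
      calc √2 * δ ≤ Real.exp 1 * Real.exp (-1) := by gcongr
        _ = 1 := by rw [← Real.exp_add]; simp
    nlinarith
  have hset : {ω | Q ω ≤ t} = {ω | t < Q ω}ᶜ := by ext; simp
  have hnull : NullMeasurableSet {ω | t < Q ω} P := nullMeasurableSet_lt aemeasurable_const hQm
  change 1 - δ ≤ P.real {ω | Q ω ≤ t}
  rw [hset, probReal_compl_eq_one_sub₀ hnull]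
  linarith

end Subgaussian

/-! ### The star graph, constant signals and the normal equations. -/

section Star

/-- The unit vectors spanning the signals that are constant in time. -/
noncomputable def constSignal (T n : ℕ) (j : Fin n) : EuclideanSpace ℝ (Fin T × Fin n) :=
  WithLp.toLp 2 fun q => if q.2 = j then (√T)⁻¹ else 0

variable {T n : ℕ}

theorem sum_smul_constSignal_apply (v : Fin n → ℝ) (q : Fin T × Fin n) :
    (∑ j, v j • constSignal T n j) q = (√T)⁻¹ * v q.2 := by
  simp [constSignal, mul_comm]

theorem orthonormal_constSignal (hT : 0 < T) : Orthonormal ℝ (constSignal T n) := by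
  rw [orthonormal_iff_ite]
  intro i j
  have h : (T : ℝ) * ((√T)⁻¹ * (√T)⁻¹) = 1 := by
    rw [← mul_inv, Real.mul_self_sqrt (by positivity), mul_inv_cancel₀ (by positivity)]
  simp only [constSignal, PiLp.inner_apply, Fintype.sum_prod_type]
  simp only [RCLike.inner_apply, conj_trivial, ite_mul, mul_ite, mul_zero, zero_mul]
  by_cases hij : i = j
  · subst hij; simp [h]
  · simp [hij]

theorem smoothnessMat_apply {r : Fin T} (o : EdgeOrientation (SimpleGraph.starGraph r))
    (x : EuclideanSpace ℝ (Fin T × Fin n)) (e : (SimpleGraph.starGraph r).edgeSet) (j : Fin n) :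
    Matrix.toEuclideanLin (smoothnessMat o n) x (e, j) = x (o.head e, j) - x (o.tail e, j) := by
  have hne : o.head e ≠ o.tail e := by
    have h := e.2
    rw [o.edge_eq e, SimpleGraph.mem_edgeSet] at h
    exact h.ne'
  simp only [Matrix.toLpLin_apply, Matrix.mulVec, dotProduct, smoothnessMat,
    Matrix.kroneckerMap_apply, incidenceMat, Matrix.of_apply, Fintype.sum_prod_type,
    Matrix.one_apply, mul_ite, mul_one, mul_zero, ite_mul, zero_mul, Finset.sum_ite_eq,
    Finset.mem_univ, if_true]
  rw [Fintype.sum_eq_add (o.head e) (o.tail e) hne]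
  · simp [hne.symm, sub_eq_add_neg]
  · rintro t ⟨h1, h2⟩
    simp [h1, h2]

theorem smoothnessMat_projSpan_constSignal {r : Fin T}
    (o : EdgeOrientation (SimpleGraph.starGraph r)) (x : EuclideanSpace ℝ (Fin T × Fin n)) :
    Matrix.toEuclideanLin (smoothnessMat o n) (projSpan (constSignal T n) x) = 0 := by
  ext ⟨e, j⟩
  rw [smoothnessMat_apply, projSpan, sum_smul_constSignal_apply, sum_smul_constSignal_apply]
  simp

/-- The nonzero eigenvalues of the Laplacian of the star graph are at least one. -/
theorem norm_sub_projSpan_constSignal_le {r : Fin T}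
    (o : EdgeOrientation (SimpleGraph.starGraph r)) (x : EuclideanSpace ℝ (Fin T × Fin n)) :
    ‖x - projSpan (constSignal T n) x‖ ^ 2
      ≤ ‖Matrix.toEuclideanLin (smoothnessMat o n) x‖ ^ 2 := by
  have hT : 0 < T := r.pos
  -- The projection is the best constant approximation, so it beats the signal frozen at the center
  -- value `x_r`. The error of the latter sums `‖x_t - x_r‖²` over `t ≠ r`, one term per edge.
  refine (norm_sub_projSpan_le (orthonormal_constSignal hT) x fun j => √T * x (r, j)).trans ?_
  rw [EuclideanSpace.real_norm_sq_eq, EuclideanSpace.real_norm_sq_eq]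
  have hT' : √(T : ℝ) ≠ 0 := by positivity
  have h1 : ∀ q : Fin T × Fin n, (x - ∑ j, (√T * x (r, j)) • constSignal T n j) q
      = x q - x (r, q.2) := by
    intro q
    rw [PiLp.sub_apply, sum_smul_constSignal_apply, inv_mul_cancel_left₀ hT']
  simp_rw [h1]
  rw [Fintype.sum_prod_type, Fintype.sum_prod_type]
  simp_rw [smoothnessMat_apply]
  let f : Fin T → ℝ := fun t => ∑ j, (x (t, j) - x (r, j)) ^ 2
  let g : (SimpleGraph.starGraph r).edgeSet → ℝ :=
    fun e => ∑ j, (x (o.head e, j) - x (o.tail e, j)) ^ 2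
  change ∑ t, f t ≤ ∑ e, g e
  have hg : ∀ e, 0 ≤ g e := fun e => Finset.sum_nonneg fun j _ => sq_nonneg _
  rw [Fintype.sum_eq_add_sum_subtype_ne f r, show f r = 0 by simp [f], zero_add]
  let φ : {t // t ≠ r} → (SimpleGraph.starGraph r).edgeSet :=
    fun t => ⟨s(r, t.1), SimpleGraph.starGraph_center_adj t.2.symm⟩
  have hφ : Function.Injective φ := by
    intro a b hab
    have : s(r, a.1) = s(r, b.1) := congrArg Subtype.val hab
    exact Subtype.ext (Sym2.congr_right.mp this)
  have hfg : ∀ t : {t // t ≠ r}, f t = g (φ t) := by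
    intro t
    have h : s(r, t.1) = s(o.tail (φ t), o.head (φ t)) := o.edge_eq (φ t)
    rw [Sym2.eq_iff] at h
    rcases h with ⟨h1, h2⟩ | ⟨h1, h2⟩
    · simp only [f, g, ← h1, ← h2]
    · simp only [f, g, ← h1, ← h2]
      exact Finset.sum_congr rfl fun j _ => by ring
  calc ∑ t : {t // t ≠ r}, f t = ∑ t : {t // t ≠ r}, g (φ t) :=
        Finset.sum_congr rfl fun t _ => hfg t
    _ = ∑ e ∈ Finset.univ.map ⟨φ, hφ⟩, g e := by rw [Finset.sum_map]; rfl
    _ ≤ ∑ e, g e :=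
        Finset.sum_le_sum_of_subset_of_nonneg (Finset.subset_univ _) fun e _ _ => hg e

theorem minEigenvalue_mul_norm_sq_le {m k : Type*} [Fintype m] [Fintype k] [DecidableEq k]
    (A : Matrix m k ℝ) (v : EuclideanSpace ℝ k) :
    minEigenvalue (isHermitian_gram A) * ‖v‖ ^ 2 ≤ ‖Matrix.toEuclideanLin A v‖ ^ 2 := by
  set hA := isHermitian_gram A
  set b := hA.eigenvectorBasis
  have h1 : ‖Matrix.toEuclideanLin A v‖ ^ 2 = ∑ i, hA.eigenvalues i * inner ℝ (b i) v ^ 2 := by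
    classical
    have hadj : ∀ w : EuclideanSpace ℝ k, inner ℝ (Matrix.toEuclideanLin A w)
        (Matrix.toEuclideanLin A v) = inner ℝ (Matrix.toEuclideanLin (Aᵀ * A) w) v := by
      intro w
      rw [← Matrix.conjTranspose_eq_transpose_of_trivial, Matrix.toLpLin_mul_same,
        LinearMap.comp_apply, Matrix.toEuclideanLin_conjTranspose_eq_adjoint,
        LinearMap.adjoint_inner_left]
    have heig : ∀ i, Matrix.toEuclideanLin (Aᵀ * A) (b i) = hA.eigenvalues i • b i := by
      intro i
      ext j
      exact congrFun (hA.mulVec_eigenvectorBasis i) j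
    rw [← real_inner_self_eq_norm_sq, hadj]
    conv_lhs => rw [← b.sum_repr' v]
    rw [map_sum, sum_inner]
    refine Finset.sum_congr rfl fun i _ => ?_
    rw [map_smul, heig, real_inner_smul_left, real_inner_smul_left, b.sum_repr' v]
    ring
  rw [h1, show ‖v‖ ^ 2 = ∑ i, inner ℝ (b i) v ^ 2 by
    rw [← b.sum_sq_norm_inner_right v]; simp, Finset.mul_sum]
  gcongr with i
  exact ciInf_le (Set.finite_range _).bddBelow i

theorem minEigenvalue_le_maxEigenvalue {k : Type*} [Fintype k] [DecidableEq k] [Nonempty k]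
    {A : Matrix k k ℝ} (hA : A.IsHermitian) : minEigenvalue hA ≤ maxEigenvalue hA :=
  ciInf_le_ciSup (Set.finite_range _).bddBelow (Set.finite_range _).bddAbove

variable {m : Fin T → ℕ} (C : (t : Fin T) → Matrix (Fin (m t)) (Fin n) ℝ)

/-- This is where the stacked matrix enters; the factor `1/√T` turns its eigenvalue bound `lo` into
`lo/T`. -/
theorem blockDiagMat_sum_smul_constSignal (v : Fin n → ℝ) :
    Matrix.toEuclideanLin (blockDiagMat C) (∑ j, v j • constSignal T n j)
      = (√T)⁻¹ • Matrix.toEuclideanLin (stackedMat C) (WithLp.toLp 2 v) := by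
  ext i
  simp only [Matrix.toLpLin_apply, Matrix.mulVec, dotProduct, blockDiagMat, stackedMat,
    Matrix.of_apply, Fintype.sum_prod_type, sum_smul_constSignal_apply, PiLp.smul_apply,
    smul_eq_mul, ite_mul, zero_mul, Finset.mul_sum]
  rw [Finset.sum_comm]
  refine Finset.sum_congr rfl fun j _ => ?_
  simp
  ring

theorem le_norm_sq_blockDiagMat_projSpan (hT : 0 < T) {lo : ℝ}
    (hlo : lo ≤ minEigenvalue (isHermitian_gram (stackedMat C)))
    (x : EuclideanSpace ℝ (Fin T × Fin n)) :
    lo / T * ‖projSpan (constSignal T n) x‖ ^ 2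
      ≤ ‖Matrix.toEuclideanLin (blockDiagMat C) (projSpan (constSignal T n) x)‖ ^ 2 := by
  rw [norm_sq_projSpan (orthonormal_constSignal hT), projSpan, blockDiagMat_sum_smul_constSignal,
    norm_smul, mul_pow]
  set v : EuclideanSpace ℝ (Fin n) := WithLp.toLp 2 fun j => inner ℝ (constSignal T n j) x with hv
  have h1 : ∑ j, inner ℝ (constSignal T n j) x ^ 2 = ‖v‖ ^ 2 := by
    rw [EuclideanSpace.real_norm_sq_eq]
  have h2 : ‖(√(T : ℝ))⁻¹‖ ^ 2 = 1 / T := by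
    rw [Real.norm_eq_abs, sq_abs, inv_pow, Real.sq_sqrt (by positivity), one_div]
  have h3 := (mul_le_mul_of_nonneg_right hlo (sq_nonneg ‖v‖)).trans
    (minEigenvalue_mul_norm_sq_le (stackedMat C) v)
  rw [h1, h2, div_mul_eq_mul_div, div_mul_eq_mul_div, one_mul]
  gcongr

open scoped Matrix.Norms.L2Operator in
theorem norm_toEuclideanLin_le {m k : Type*} [Fintype m] [Fintype k] [DecidableEq k]
    (A : Matrix m k ℝ) (v : EuclideanSpace ℝ k) :
    ‖Matrix.toEuclideanLin A v‖ ≤ matSpectralNorm A * ‖v‖ :=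
  A.l2_opNorm_mulVec v

open scoped Matrix.Norms.L2Operator in
theorem matSpectralNorm_nonneg {m k : Type*} [Fintype m] [Fintype k] [DecidableEq k]
    (A : Matrix m k ℝ) : 0 ≤ matSpectralNorm A :=
  norm_nonneg A

/-- The normal equations in weak form: along each line `z + t d` the objective is a quadratic in `t`
minimal at `0`. -/
theorem IsPenalizedLS.inner_eq {k l p : Type*} [Fintype k] [Fintype l] [Fintype p] [DecidableEq p]
    {C : Matrix k p ℝ} {M : Matrix l p ℝ} {μ : ℝ} {y : EuclideanSpace ℝ k}
    {z : EuclideanSpace ℝ p} (h : IsPenalizedLS C M μ y z) (d : EuclideanSpace ℝ p) :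
    inner ℝ (Matrix.toEuclideanLin C d) (Matrix.toEuclideanLin C z - y)
      + μ * inner ℝ (Matrix.toEuclideanLin M d) (Matrix.toEuclideanLin M z) = 0 := by
  refine eq_zero_of_quadratic_nonneg (b := 1 / 2 * ‖Matrix.toEuclideanLin C d‖ ^ 2
    + μ / 2 * ‖Matrix.toEuclideanLin M d‖ ^ 2) fun t => ?_
  have h1 := h (z + t • d)
  simp only [penalizedObjective] at h1
  have h2 : ‖y - Matrix.toEuclideanLin C (z + t • d)‖ ^ 2
      = ‖y - Matrix.toEuclideanLin C z‖ ^ 2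
        + 2 * (t * inner ℝ (Matrix.toEuclideanLin C d) (Matrix.toEuclideanLin C z - y))
        + t ^ 2 * ‖Matrix.toEuclideanLin C d‖ ^ 2 := by
    rw [norm_sub_rev, map_add, map_smul, add_sub_right_comm, norm_add_sq_real,
      norm_sub_rev y, real_inner_smul_right, norm_smul, mul_pow, real_inner_comm]
    simp
  have h3 : ‖Matrix.toEuclideanLin M (z + t • d)‖ ^ 2 = ‖Matrix.toEuclideanLin M z‖ ^ 2
        + 2 * (t * inner ℝ (Matrix.toEuclideanLin M d) (Matrix.toEuclideanLin M z))
        + t ^ 2 * ‖Matrix.toEuclideanLin M d‖ ^ 2 := by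
    rw [map_add, map_smul, norm_add_sq_real, real_inner_smul_right, norm_smul, mul_pow,
      real_inner_comm]
    simp
  rw [h2, h3] at h1
  linarith

end Star

/-! ### The choice of `μ` and the main theorem. -/

theorem starErrorBound_bound {n T : ℕ} {σ c lo up S L μ : ℝ} (hT : 0 < T)
    (hlo : 0 < lo) (hup : lo ≤ up) (hS : 0 < S) (hL : 1 < L)
    (hμ : μ = muStar 1 n T σ c lo up S) :
    2 * (8 * σ ^ 2 * (12 * n * c ^ 2 * T ^ 2 / lo ^ 2 + 2 * n * T * c ^ 2 / μ ^ 2) * L)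
        + 2 * (μ * S / (lo / T / 2))
      ≤ 200 * (S + c ^ 2 * (up / lo ^ 2) * T * S
        + ((n * σ ^ 2 * c ^ 2) ^ (1 / 3 : ℝ) * T * S ^ (2 / 3 : ℝ) / lo ^ (2 / 3 : ℝ)
          + n * σ ^ 2 * c ^ 2 * T ^ 2 / lo ^ 2) * L) := by
  have hT' : (0 : ℝ) < T := by exact_mod_cast hT
  have hup0 : 0 < up := hlo.trans_le hup
  have cube : ∀ a : ℝ, 0 ≤ a → (a ^ (1 / 3 : ℝ)) ^ 3 = a := fun a ha => by
    rw [← Real.rpow_natCast, ← Real.rpow_mul ha]; norm_num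
  have sqr : ∀ a : ℝ, 0 ≤ a → a ^ (2 / 3 : ℝ) = (a ^ (1 / 3 : ℝ)) ^ 2 := fun a ha => by
    rw [← Real.rpow_natCast, ← Real.rpow_mul ha]; norm_num
  rw [sqr S hS.le, sqr lo hlo.le]
  rw [muStar] at hμ
  have hK0 : 0 ≤ n * σ ^ 2 * c ^ 2 := by positivity
  rw [show 2 * n * σ ^ 2 * c ^ 2 = 2 * (n * σ ^ 2 * c ^ 2) by ring] at hμ
  set K := n * σ ^ 2 * c ^ 2 with hK
  have hk3 := cube K hK0
  have hq3 := cube (2 * K) (by positivity)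
  have hs3 := cube S hS.le
  have hl3 := cube lo hlo.le
  have hk0 : 0 ≤ K ^ (1 / 3 : ℝ) := by positivity
  have hs0 : 0 < S ^ (1 / 3 : ℝ) := by positivity
  have hl0 : 0 < lo ^ (1 / 3 : ℝ) := by positivity
  have hkq : K ^ (1 / 3 : ℝ) ≤ (2 * K) ^ (1 / 3 : ℝ) := by gcongr; linarith
  have hqk : (2 * K) ^ (1 / 3 : ℝ) ≤ 2 * K ^ (1 / 3 : ℝ) := by
    refine le_of_pow_le_pow_left₀ three_ne_zero (by positivity) ?_
    rw [mul_pow, hq3, hk3]; linarith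
  set k := K ^ (1 / 3 : ℝ)
  set q := (2 * K) ^ (1 / 3 : ℝ)
  set s := S ^ (1 / 3 : ℝ)
  set l := lo ^ (1 / 3 : ℝ)
  have hμ1 : q * (l / s) - lo / T ≤ μ := hμ ▸ le_max_left _ _
  have hμ2 : lo / T + c ^ 2 * (up / lo) ≤ μ := by
    rw [← one_mul (_ + _)]; exact hμ ▸ le_max_right _ _
  have hloT : lo / T ≤ μ := le_trans (le_add_of_nonneg_right (by positivity)) hμ2
  have hμ0 : 0 < μ := lt_of_lt_of_le (by positivity) hloT
  set B := k * T * s ^ 2 / l ^ 2 with hB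
  have hB0 : 0 ≤ B := by positivity
  -- Adding the two lower bounds on `μ` cancels the `- lo / T` in `muStar`, so `q (l/s) ≤ 2μ`.
  have h1 : K * T / μ ^ 2 ≤ 4 * B := by
    have h2 : k * (l / s) ≤ 2 * μ := by
      have : k * (l / s) ≤ q * (l / s) := by gcongr
      linarith
    have h3 : (k * (l / s)) ^ 2 ≤ (2 * μ) ^ 2 := pow_le_pow_left₀ (by positivity) h2 2
    rw [div_le_iff₀ (by positivity)]
    have h4 : B * (k * (l / s)) ^ 2 = K * T := by
      rw [hB, ← hk3]; field_simp
    nlinarith [mul_le_mul_of_nonneg_left h3 hB0]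
  have h5 : μ * S / (lo / T / 2) ≤ 4 * B + 2 * (S + c ^ 2 * (up / lo ^ 2) * T * S) := by
    have h6 : 0 ≤ c ^ 2 * (up / lo ^ 2) * T * S := by positivity
    have h7 : μ * S / (lo / T / 2) = μ * (2 * S * T / lo) := by field_simp
    rw [h7]
    -- The bias is linear in `μ`: the first branch of the maximum yields `B`, the second the
    -- noise-free terms.
    rcases le_max_iff.mp hμ.le with h | h
    · have h8 : μ ≤ 2 * k * (l / s) := by
        have h9 : q * (l / s) ≤ 2 * k * (l / s) := by gcongr
        have : 0 < lo / T := by positivity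
        linarith
      have h10 : 2 * k * (l / s) * (2 * S * T / lo) = 4 * B := by
        rw [hB, ← hs3, ← hl3]; field_simp; ring
      have h11 : μ * (2 * S * T / lo) ≤ 2 * k * (l / s) * (2 * S * T / lo) := by gcongr
      linarith
    · have h10 : 1 * (lo / T + c ^ 2 * (up / lo)) * (2 * S * T / lo)
          = 2 * (S + c ^ 2 * (up / lo ^ 2) * T * S) := by
        field_simp
      have h11 : μ * (2 * S * T / lo) ≤ 1 * (lo / T + c ^ 2 * (up / lo)) * (2 * S * T / lo) := by
        gcongr
      linarith
  have h12 : 2 * (8 * σ ^ 2 * (12 * n * c ^ 2 * T ^ 2 / lo ^ 2 + 2 * n * T * c ^ 2 / μ ^ 2) * L)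
      = 192 * (K * T ^ 2 / lo ^ 2 * L) + 32 * (K * T / μ ^ 2 * L) := by
    rw [hK]; ring
  rw [h12]
  have h13 : K * T / μ ^ 2 * L ≤ 4 * B * L := by gcongr
  have h14 : B ≤ B * L := le_mul_of_one_le_right hB0 hL.le
  have h15 : 0 ≤ K * T ^ 2 / lo ^ 2 * L := by positivity
  have h16 : 0 ≤ c ^ 2 * (up / lo ^ 2) * T * S := by positivity
  -- The coefficients are 192 on `K T² L / lo²`, at most 128 + 8 on `B L`, and 4 on the noise-free
  -- terms, all below 200.
  linarith

theorem mainTheorem7 :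
    ∃ c₁ : ℝ, 0 < c₁ ∧ ∃ c₂ : ℝ, 0 < c₂ ∧
      ∀ (T n : ℕ) (r : Fin T) (o : EdgeOrientation (SimpleGraph.starGraph r))
        (m : Fin T → ℕ) (C : (t : Fin T) → Matrix (Fin (m t)) (Fin n) ℝ)
        (lo up S : ℝ) (σ : ℝ≥0) (x : EuclideanSpace ℝ (Fin T × Fin n)),
        1 ≤ n →
        0 < lo → lo ≤ minEigenvalue (isHermitian_gram (stackedMat C)) →
        0 < up → maxEigenvalue (isHermitian_gram (stackedMat C)) ≤ up →
        0 < S → ‖Matrix.toEuclideanLin (smoothnessMat o n) x‖ ^ 2 ≤ S →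
        ∀ (Ω : Type*) [MeasurableSpace Ω] (P : Measure Ω) [IsProbabilityMeasure P]
          (η : Ω → EuclideanSpace ℝ (Σ t, Fin (m t))),
          IsSubgaussianVector η σ P →
          ∀ xhat : Ω → EuclideanSpace ℝ (Fin T × Fin n),
            (∀ ω, IsPenalizedLS (blockDiagMat C) (smoothnessMat o n)
              (muStar c₁ n T σ (matSpectralNorm (blockDiagMat C)) lo up S)
              (Matrix.toEuclideanLin (blockDiagMat C) x + η ω) (xhat ω)) →
            ∀ δ : ℝ, 0 < δ → δ < Real.exp (-1) →
              1 - δ ≤ P.real {ω | ‖xhat ω - x‖ ^ 2 ≤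
                c₂ * starErrorBound n T σ (matSpectralNorm (blockDiagMat C)) lo up S δ} := by
  refine ⟨1, one_pos, 200, by norm_num, ?_⟩
  intro T n r o m C lo up S σ x hn hlo hmin _ hmax hS hMx Ω _ P _ η hη xhat hxhat δ hδ0 hδ
  have hT : 0 < T := r.pos
  have hT' : (0 : ℝ) < T := by exact_mod_cast hT
  have : Nonempty (Fin n) := ⟨⟨0, hn⟩⟩
  -- With `up / lo ≥ 1`, the second branch of `muStar` at `c₁ = 1` already gives `μ ≥ lo/T + c²`.
  have hup : lo ≤ up := hmin.trans ((minEigenvalue_le_maxEigenvalue _).trans hmax)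
  set A := Matrix.toEuclideanLin (blockDiagMat C)
  set M := Matrix.toEuclideanLin (smoothnessMat o n)
  set c := matSpectralNorm (blockDiagMat C)
  have hc : 0 ≤ c := matSpectralNorm_nonneg _
  have hA : ∀ e, ‖A e‖ ≤ c * ‖e‖ := norm_toEuclideanLin_le _
  set μ := muStar 1 n T σ c lo up S with hμdef
  have hμ : lo / T + c ^ 2 ≤ μ := by
    have h1 : 1 * (lo / T + c ^ 2 * (up / lo)) ≤ μ := le_max_right _ _
    have h2 : c ^ 2 ≤ c ^ 2 * (up / lo) :=
      le_mul_of_one_le_right (sq_nonneg c) ((one_le_div hlo).mpr hup)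
    linarith
  have hloT : 0 < lo / T := by positivity
  have hμ0 : 0 < μ := by nlinarith [sq_nonneg c]
  have hp := orthonormal_constSignal (n := n) hT
  have hM : ∀ e, ‖e - projSpan (constSignal T n) e‖ ^ 2 ≤ ‖M e‖ ^ 2 :=
    norm_sub_projSpan_constSignal_le o
  have hco := coercive_penalized hp A M hμ hloT.le hA hM
    (le_norm_sq_blockDiagMat_projSpan C hT hmin)
  have hκ : 0 < lo / T / 2 := by positivity
  choose g hg using fun j => exists_penalized_solution A M hκ hco (constSignal T n j)
  obtain ⟨b, hb⟩ := exists_penalized_solution A M hκ hco (-(μ • M.adjoint (M x)))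
  have hb' : ∀ d, inner ℝ (A d) (A b) + μ * inner ℝ (M d) (M b) = -(μ * inner ℝ (M d) (M x)) := by
    intro d
    rw [hb, inner_neg_right, real_inner_smul_right, LinearMap.adjoint_inner_right]
  have hbias := norm_sq_bias_le A M hκ hμ0 hco hb'
  let B := EuclideanSpace.basisFun (Fin T × Fin n) ℝ
  -- The weights `√3` and `√2 / μ` make `∑ ⟨a k, η⟩²` exactly the bound of `norm_sq_noise_le`, so
  -- one concentration event covers both parts.
  let a : Fin n ⊕ (Fin T × Fin n) → EuclideanSpace ℝ (Σ t, Fin (m t)) :=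
    Sum.elim (fun j => √3 • A (g j)) (fun i => (√2 / μ) • A (B i))
  have ha : ∑ k, ‖a k‖ ^ 2
      ≤ 12 * n * c ^ 2 * T ^ 2 / lo ^ 2 + 2 * n * T * c ^ 2 / μ ^ 2 := by
    have h1 : ∀ j, ‖√3 • A (g j)‖ ^ 2 ≤ 12 * c ^ 2 * T ^ 2 / lo ^ 2 := by
      intro j
      have h2 := norm_penalized_solution_le A M hκ hco (hg j)
      rw [hp.1 j] at h2
      have h3 : ‖A (g j)‖ ≤ c * (1 / (lo / T / 2)) := (hA _).trans (by gcongr)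
      rw [norm_smul, mul_pow, Real.norm_eq_abs, sq_abs, Real.sq_sqrt (by norm_num)]
      calc 3 * ‖A (g j)‖ ^ 2 ≤ 3 * (c * (1 / (lo / T / 2))) ^ 2 := by gcongr
        _ = 12 * c ^ 2 * T ^ 2 / lo ^ 2 := by field_simp; ring
    have h4 : ∀ i, ‖(√2 / μ) • A (B i)‖ ^ 2 ≤ 2 * c ^ 2 / μ ^ 2 := by
      intro i
      have h5 := hA (B i)
      rw [B.orthonormal.1 i, mul_one] at h5
      rw [norm_smul, mul_pow, Real.norm_eq_abs, sq_abs, div_pow, Real.sq_sqrt (by norm_num)]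
      calc 2 / μ ^ 2 * ‖A (B i)‖ ^ 2 ≤ 2 / μ ^ 2 * c ^ 2 := by gcongr
        _ = 2 * c ^ 2 / μ ^ 2 := by ring
    rw [Fintype.sum_sum_type]
    refine (add_le_add (Finset.sum_le_sum fun j _ => h1 j)
      (Finset.sum_le_sum fun i _ => h4 i)).trans_eq ?_
    simp
    ring
  refine (hη.one_sub_le_measureReal_sum_sq_le a ha hδ0 hδ).trans (measureReal_mono fun ω hω => ?_)
  have hL : 1 < Real.log (1 / δ) := by
    rw [one_div, Real.log_inv, lt_neg, Real.log_lt_iff_lt_exp hδ0]; exact hδ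
  -- Subtracting the bias equation from the normal equations leaves only `η` as a source.
  have he : ∀ d, inner ℝ (A d) (A (xhat ω - x - b)) + μ * inner ℝ (M d) (M (xhat ω - x - b))
      = inner ℝ (A d) (η ω) := by
    intro d
    have h1 := (hxhat ω).inner_eq d
    have h2 := hb' d
    simp only [map_sub, inner_sub_right, inner_add_right] at h1 h2 ⊢
    linarith
  have hnoise := norm_sq_noise_le hp B A M hc hμ0 (by linarith) hA hM
    (smoothnessMat_projSpan_constSignal o) hg he
  have hsum : ∑ k, inner ℝ (a k) (η ω) ^ 2 = 3 * ∑ j, inner ℝ (A (g j)) (η ω) ^ 2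
      + 2 / μ ^ 2 * ∑ i, inner ℝ (A (B i)) (η ω) ^ 2 := by
    rw [Fintype.sum_sum_type, Finset.mul_sum, Finset.mul_sum]
    simp only [a, Sum.elim_inl, Sum.elim_inr, real_inner_smul_left, mul_pow, div_pow,
      Real.sq_sqrt zero_le_two, Real.sq_sqrt zero_le_three]
  have hω' : ∑ k, inner ℝ (a k) (η ω) ^ 2 ≤ _ := hω
  rw [hsum] at hω'
  have htri : ‖xhat ω - x‖ ^ 2 ≤ 2 * ‖xhat ω - x - b‖ ^ 2 + 2 * ‖b‖ ^ 2 := by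
    have h1 := norm_add_le (xhat ω - x - b) b
    rw [sub_add_cancel] at h1
    have h2 := pow_le_pow_left₀ (norm_nonneg _) h1 2
    nlinarith [sq_nonneg (‖xhat ω - x - b‖ - ‖b‖)]
  have hbias' : ‖b‖ ^ 2 ≤ μ * S / (lo / T / 2) := hbias.trans (by gcongr)
  have hfinal := starErrorBound_bound hT hlo hup hS hL hμdef
  change ‖xhat ω - x‖ ^ 2 ≤ 200 * starErrorBound n T σ c lo up S δ
  rw [starErrorBound]
  linarith
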